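/- Let $0\le\mu<\infty$ and $0<p\le q<\infty$. A weight on $\mathbb{R}$ is a measurable function $w:\mathbb{R}\to[0,\infty)$ with $w>0$ almost everywhere. For a measurable function $f:\mathbb{R}\to[-\infty,\infty]$ let $$m_\mu^+(f)(x)=\inf_{h>0}\frac{1}{h^{1+\mu}}\int_x^{x+h}|f(t)|\,dt\in[0,\infty]$$ be the fractional one-sided minimal function of order $\mu$. Let $(U,V)$ be a pair of weights on $\mathbb{R}$ and put $\omega=V^{1/(p+1)}$; for an interval $I$ let $\omega/\chi_I$ denote the function equal to $\omega$ on $I$ and to $+\infty$ outside $I$. All integrals take values in $[0,\infty]$, with $c/0=\infty$ for $c>0$ and $c/\infty=0$ for $0\le c<\infty$. Then the following statements are equivalent. (i) $(U,V)\in(W_{p,q}^+)^*$, that is, there is a constant $0<C<\infty$ such that for every interval $I=[a,b]$ with $-\infty<a<b<\infty$, $$\int_I\frac{U}{m_\mu^+(\omega/\chi_I)^q}\,dx\le C\Big(\int_I\omega\,dx\Big)^{q/p}.$$ (ii) The strong $(p,q)$ inequality holds for $m_\mu^+$, that is, there is a constant $0<C<\infty$ such that for every measurable $f:\mathbb{R}\to[-\infty,\infty]$,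 $$\int_{\mathbb{R}}\frac{U}{m_\mu^+(f)^q}\,dx\le C\Big(\int_{\mathbb{R}}\frac{V}{|f|^p}\,dx\Big)^{q/p}.$$ -/

import Mathlib

open MeasureTheory
open scoped ENNReal

noncomputable section

/-- A weight on `ℝ`: a (Lebesgue measurable) non-negative function, positive almost everywhere.
No local integrability is required. -/
structure IsWeight (w : ℝ → ℝ) : Prop where
  aemeasurable : AEMeasurable w volume
  nonneg : ∀ x, 0 ≤ w x
  pos_ae : ∀ᵐ x ∂(volume : Measure ℝ), 0 < w x

/-- The fractional one-sided minimal function of order `μ` of an extended real valued `f`: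
`inf_{h > 0} h^{-(1+μ)} ∫_x^{x+h} |f|`. -/
def minimalPlus (μ : ℝ) (f : ℝ → EReal) (x : ℝ) : ℝ≥0∞ :=
  ⨅ (h : ℝ) (_ : 0 < h),
    (∫⁻ t in Set.Ioc x (x + h), (f t).abs) / ENNReal.ofReal (h ^ (1 + μ))

/-- `ω = V^{1/(p+1)}`. -/
def omegaWeight (p : ℝ) (V : ℝ → ℝ) (x : ℝ) : ℝ := V x ^ (1 / (p + 1))

open Classical in
/-- The function `w / χ_I`: equal to `w` on `I` and to `+∞` outside `I`. -/
def divIndicator (w : ℝ → ℝ) (I : Set ℝ) (x : ℝ) : EReal :=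
  if x ∈ I then (w x : EReal) else ⊤

/-- The Sawyer-type testing condition `(W_{p,q}^+)^*` for the pair `(U, V)`; the constant is
uniform over all intervals. -/
def TestingCondition (μ p q : ℝ) (U V : ℝ → ℝ) : Prop :=
  ∃ C : ℝ, 0 < C ∧ ∀ a b : ℝ, a < b →
    ∫⁻ x in Set.Icc a b, ENNReal.ofReal (U x) /
        (minimalPlus μ (divIndicator (omegaWeight p V) (Set.Icc a b)) x) ^ q
      ≤ ENNReal.ofReal C *
        (∫⁻ x in Set.Icc a b, ENNReal.ofReal (omegaWeight p V x)) ^ (q / p)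

/-- The two weight strong `(p, q)` inequality for the minimal function; the constant is uniform
over all measurable extended real valued `f`. Here `c / 0 = ∞` for `c > 0` and `c / ∞ = 0`. -/
def StrongTypeInequality (μ p q : ℝ) (U V : ℝ → ℝ) : Prop :=
  ∃ C : ℝ, 0 < C ∧ ∀ f : ℝ → EReal, AEMeasurable f volume →
    ∫⁻ x, ENNReal.ofReal (U x) / (minimalPlus μ f x) ^ q
      ≤ ENNReal.ofReal C *
        (∫⁻ x, ENNReal.ofReal (V x) / (f x).abs ^ p) ^ (q / p)

end

/-!
Put `w = ω`, so that `V / |f| ^ p = (w / |f|) ^ p * w`. That the testing condition follows from the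
strong type inequality is seen from `f = ω / χ_I`. For the converse let `F = |f|` and let `M` be the
maximal function of the ratios `(∫_I w) / (∫_I F)` over the open intervals `I` containing a point.

If `∫_I w > r ∫_I F`, then by Chebyshev's inequality the set `{2 w / F > r}` carries at least half
of the `w`-mass of `I`. Covering `{M > r}` by such intervals with overlap at most two gives
`w {M > r} ≤ 4 w {2 w / F > r}`, and summation over `r ^ p = 2 ^ k` gives
`∑ 2 ^ (k + 1) w {M ^ p > 2 ^ k} ≤ 16 * 2 ^ p ∫ (w / F) ^ p w`.

An interval with `2 ^ k < ((∫ w) / (∫ F)) ^ p ≤ 2 ^ (k + 1)` lies in the open set `{M ^ p > 2 ^ k}`,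
and replacing `F` by `w` in its average costs the factor `2 ^ (k + 1)`, raised to the power `q / p`.
After this replacement the testing condition on the maximal intervals of `{M ^ p > 2 ^ k}` applies.
Because `q / p ≥ 1`, the sums of `(q / p)`-th powers are at most the power of the sum.
-/

open Set

theorem tsum_rpow_le_rpow_tsum {ι : Type*} (a : ι → ℝ≥0∞) {s : ℝ} (hs : 1 ≤ s) :
    ∑' i, a i ^ s ≤ (∑' i, a i) ^ s := by
  classical
  rw [ENNReal.tsum_eq_iSup_sum]
  refine iSup_le fun T => le_trans ?_
    (ENNReal.rpow_le_rpow (ENNReal.sum_le_tsum T) (zero_le_one.trans hs))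
  induction T using Finset.induction_on with
  | empty => simp
  | insert i T hi ih =>
    rw [Finset.sum_insert hi, Finset.sum_insert hi]
    exact (add_le_add le_rfl ih).trans (ENNReal.add_rpow_le_rpow_add _ _ hs)

theorem tsum_two_zpow_lt_le (y : ℝ≥0∞) :
    ∑' k : ℤ, {k : ℤ | (2 : ℝ≥0∞) ^ k < y}.indicator (2 ^ ·) k ≤ 2 * y := by
  rcases eq_or_ne y 0 with rfl | h0
  · simp
  rcases eq_or_ne y ∞ with rfl | htop
  · simp
  obtain ⟨n, hn, hyn⟩ := ENNReal.exists_mem_Ioc_zpow h0 htop ENNReal.one_lt_two ENNReal.ofNat_ne_top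
  have hinj : Function.Injective (fun j : ℕ => n - (j : ℤ)) := fun i j h => by simpa using h
  have hsupp : Function.support ({k : ℤ | (2 : ℝ≥0∞) ^ k < y}.indicator ((2 : ℝ≥0∞) ^ ·)) ⊆
      range fun j : ℕ => n - (j : ℤ) := by
    intro k hk
    have hky : (2 : ℝ≥0∞) ^ k < y := by_contra fun h =>
      hk (indicator_of_notMem (s := {k : ℤ | (2 : ℝ≥0∞) ^ k < y}) h _)
    have hkn : k < n + 1 := by
      by_contra! h
      exact absurd (hky.trans_le hyn) (ENNReal.zpow_le_of_le one_le_two h).not_gt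
    exact ⟨(n - k).toNat, by simp only; omega⟩
  rw [← hinj.tsum_eq hsupp]
  calc ∑' j : ℕ, {k : ℤ | (2 : ℝ≥0∞) ^ k < y}.indicator (2 ^ ·) (n - (j : ℤ))
      ≤ ∑' j : ℕ, (2 : ℝ≥0∞) ^ n * 2⁻¹ ^ j := by
        refine ENNReal.tsum_le_tsum fun j => (indicator_le_self _ _ _).trans_eq ?_
        rw [sub_eq_add_neg, ENNReal.zpow_add two_ne_zero (by simp), ENNReal.zpow_neg,
          zpow_natCast, ENNReal.inv_pow]
    _ = 2 * 2 ^ n := by rw [ENNReal.tsum_mul_left, ENNReal.tsum_geometric_two, mul_comm]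
    _ ≤ 2 * y := by gcongr

theorem div_iInf_rpow {ι : Sort*} (u : ℝ≥0∞) (m : ι → ℝ≥0∞) {q : ℝ} (hq : 0 < q) :
    u / (⨅ i, m i) ^ q = ⨆ i, u / m i ^ q := by
  have hpow : (⨅ i, m i) ^ q = ⨅ i, m i ^ q := (ENNReal.orderIsoRpow q hq).map_iInf m
  simp only [hpow, div_eq_mul_inv, ENNReal.inv_iInf, ENNReal.mul_iSup]

section LintegralComparison

variable {α : Type*} [MeasurableSpace α] {ν : Measure α} {w F φ : α → ℝ≥0∞}

theorem tsum_two_zpow_mul_setLIntegral_le (hφ : AEMeasurable φ ν) (hw : AEMeasurable w ν) :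
    ∑' k : ℤ, 2 ^ k * ∫⁻ t in {t | 2 ^ k < φ t}, w t ∂ν ≤ 2 * ∫⁻ t, φ t * w t ∂ν := by
  have hlevel (k : ℤ) : NullMeasurableSet {t | 2 ^ k < φ t} ν :=
    nullMeasurableSet_lt aemeasurable_const hφ
  calc ∑' k : ℤ, 2 ^ k * ∫⁻ t in {t | 2 ^ k < φ t}, w t ∂ν
      = ∑' k : ℤ, ∫⁻ t, 2 ^ k * {t | 2 ^ k < φ t}.indicator w t ∂ν := by
        refine tsum_congr fun k => ?_
        rw [lintegral_const_mul' _ _ (ENNReal.zpow_ne_top two_ne_zero (by simp) k),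
          lintegral_indicator₀ (hlevel k)]
    _ = ∫⁻ t, ∑' k : ℤ, 2 ^ k * {t | 2 ^ k < φ t}.indicator w t ∂ν :=
        (lintegral_tsum fun k => (hw.indicator₀ (hlevel k)).const_mul _).symm
    _ = ∫⁻ t, (∑' k : ℤ, {k : ℤ | (2 : ℝ≥0∞) ^ k < φ t}.indicator (2 ^ ·) k) * w t ∂ν := by
        simp only [← ENNReal.tsum_mul_right, indicator_apply, mem_ofPred_eq, mul_ite, ite_mul,
          mul_zero, zero_mul]
    _ ≤ ∫⁻ t, 2 * φ t * w t ∂ν := by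
        gcongr with t
        exact tsum_two_zpow_lt_le (φ t)
    _ = 2 * ∫⁻ t, φ t * w t ∂ν := by
        simp only [mul_assoc, lintegral_const_mul' 2 _ ENNReal.ofNat_ne_top]

theorem lintegral_le_two_mul_setLIntegral_of_lt_div (hw : AEMeasurable w ν)
    (hF : AEMeasurable F ν) {r : ℝ≥0∞} (hr : r ≠ 0) (h : r < (∫⁻ t, w t ∂ν) / ∫⁻ t, F t ∂ν) :
    ∫⁻ t, w t ∂ν ≤ 2 * ∫⁻ t in {t | r < 2 * (w t / F t)}, w t ∂ν := by
  set A := {t | r < 2 * (w t / F t)}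
  have hAm : NullMeasurableSet A ν :=
    nullMeasurableSet_lt aemeasurable_const ((hw.div hF).const_mul 2)
  have hpt (t : α) : 2 * w t ≤ 2 * A.indicator w t + r * F t := by
    by_cases ht : t ∈ A
    · simp [ht]
    · have hle : 2 * w t / F t ≤ r := by rw [mul_div_assoc]; exact not_lt.1 ht
      exact le_add_left ((ENNReal.div_le_iff_le_mul (.inr h.ne_top) (.inr hr)).1 hle)
  have hint : 2 * ∫⁻ t, w t ∂ν ≤ 2 * ∫⁻ t in A, w t ∂ν + r * ∫⁻ t, F t ∂ν := by
    rw [← lintegral_indicator₀ hAm, ← lintegral_const_mul' 2 _ ENNReal.ofNat_ne_top,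
      ← lintegral_const_mul' 2 _ ENNReal.ofNat_ne_top, ← lintegral_const_mul' r _ h.ne_top,
      ← lintegral_add_left' ((hw.indicator₀ hAm).const_mul 2)]
    exact lintegral_mono hpt
  by_contra! hlt
  refine hint.not_gt ?_
  rw [two_mul (∫⁻ t, w t ∂ν)]
  exact ENNReal.add_lt_add hlt (ENNReal.mul_lt_of_lt_div h)

theorem lintegral_le_lintegral_add_lintegral_div_rpow_mul (hF : AEMeasurable F ν) {p : ℝ}
    (hp : 0 < p) : ∫⁻ t, w t ∂ν ≤ ∫⁻ t, F t ∂ν + ∫⁻ t, (w t / F t) ^ p * w t ∂ν := by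
  rw [← lintegral_add_left' hF]
  refine lintegral_mono fun t => ?_
  rcases le_total (w t / F t) 1 with hle | hge
  · refine le_add_right ?_
    simpa using (ENNReal.div_le_iff_le_mul (.inr ENNReal.one_ne_top) (.inr one_ne_zero)).1 hle
  · exact le_add_left (le_mul_of_one_le_left' (ENNReal.one_le_rpow hge hp))

theorem ae_ne_zero_of_lintegral_div_rpow_mul_ne_top (hw : AEMeasurable w ν)
    (hF : AEMeasurable F ν) (hw0 : ∀ᵐ t ∂ν, w t ≠ 0) {p : ℝ} (hp : 0 < p)
    (h : ∫⁻ t, (w t / F t) ^ p * w t ∂ν ≠ ∞) : ∀ᵐ t ∂ν, F t ≠ 0 := by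
  filter_upwards [hw0, ae_lt_top' (((hw.div hF).pow_const p).mul hw) h] with t ht hlt hFt
  have htop : (w t / F t) ^ p * w t = ∞ := by
    rw [hFt, ENNReal.div_zero ht, ENNReal.top_rpow_of_pos hp, ENNReal.top_mul ht]
  exact hlt.ne htop

theorem lintegral_ne_zero_of_ae_ne_zero (hν : ν ≠ 0) (hw : AEMeasurable w ν)
    (hw0 : ∀ᵐ t ∂ν, w t ≠ 0) : ∫⁻ t, w t ∂ν ≠ 0 := by
  intro h
  have := ae_neBot.2 hν
  obtain ⟨t, ht, ht0⟩ := (hw0.and ((lintegral_eq_zero_iff' hw).1 h)).exists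
  exact ht ht0

end LintegralComparison

section IntervalCovering

variable {α : Type*} [LinearOrder α]

theorem exists_Ioo_subset_biUnion_erase [DecidableEq α] {S : Finset (α × α)} {x : α}
    (hx : 2 < (S.filter fun i => x ∈ Ioo i.1 i.2).card) :
    ∃ m ∈ S, Ioo m.1 m.2 ⊆ ⋃ i ∈ S.erase m, Ioo i.1 i.2 := by
  set A := S.filter fun i => x ∈ Ioo i.1 i.2
  have hA : A.Nonempty := Finset.card_pos.1 (by omega)
  obtain ⟨l, hl, hlmin⟩ := A.exists_min_image Prod.fst hA
  obtain ⟨u, hu, humax⟩ := A.exists_max_image Prod.snd hA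
  obtain ⟨m, hm, hml, hmu⟩ : ∃ m ∈ A, m ≠ l ∧ m ≠ u := by
    obtain ⟨m, hm, hmlu⟩ := Finset.exists_mem_notMem_of_card_lt_card
      (Finset.card_le_two.trans_lt hx : ({l, u} : Finset (α × α)).card < A.card)
    exact ⟨m, hm, by simpa using hmlu⟩
  obtain ⟨hlS, hxl⟩ := Finset.mem_filter.1 hl
  obtain ⟨huS, hxu⟩ := Finset.mem_filter.1 hu
  refine ⟨m, (Finset.mem_filter.1 hm).1, fun y hy => ?_⟩
  rcases lt_or_ge y x with hyx | hxy
  · exact mem_biUnion (Finset.mem_erase.2 ⟨hml.symm, hlS⟩)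
      ⟨(hlmin m hm).trans_lt hy.1, hyx.trans hxl.2⟩
  · exact mem_biUnion (Finset.mem_erase.2 ⟨hmu.symm, huS⟩)
      ⟨hxu.1.trans_le hxy, hy.2.trans_le (humax m hm)⟩

theorem exists_subfamily_Ioo_card_le_two (S : Finset (α × α)) :
    ∃ T ⊆ S, (⋃ i ∈ T, Ioo i.1 i.2) = (⋃ i ∈ S, Ioo i.1 i.2) ∧
      ∀ x, (T.filter fun i => x ∈ Ioo i.1 i.2).card ≤ 2 := by
  classical
  induction S using Finset.strongInduction with
  | H S ih =>
  by_cases hS : ∀ x, (S.filter fun i => x ∈ Ioo i.1 i.2).card ≤ 2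
  · exact ⟨S, subset_rfl, rfl, hS⟩
  push Not at hS
  obtain ⟨x, hx⟩ := hS
  obtain ⟨m, hmS, hm⟩ := exists_Ioo_subset_biUnion_erase hx
  obtain ⟨T, hT, hTU, hT2⟩ := ih (S.erase m) (Finset.erase_ssubset hmS)
  refine ⟨T, hT.trans (Finset.erase_subset _ _), hTU.trans ?_, hT2⟩
  conv_rhs => rw [← Finset.insert_erase hmS, Finset.set_biUnion_insert]
  exact (union_eq_self_of_subset_left hm).symm

variable [TopologicalSpace α] [OrderTopology α] [MeasurableSpace α] [OpensMeasurableSpace α]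
  {σ τ : Measure α} {c : ℝ≥0∞}

theorem measure_biUnion_finset_Ioo_le (S : Finset (α × α))
    (h : ∀ i ∈ S, σ (Ioo i.1 i.2) ≤ c * τ (Ioo i.1 i.2)) :
    σ (⋃ i ∈ S, Ioo i.1 i.2) ≤ c * (2 * τ univ) := by
  obtain ⟨T, hT, hTU, hT2⟩ := exists_subfamily_Ioo_card_le_two S
  rw [← hTU]
  calc σ (⋃ i ∈ T, Ioo i.1 i.2) ≤ ∑ i ∈ T, σ (Ioo i.1 i.2) := measure_biUnion_finset_le _ _
    _ ≤ ∑ i ∈ T, c * τ (Ioo i.1 i.2) := Finset.sum_le_sum fun i hi => h i (hT hi)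
    _ = c * ∫⁻ x, ∑ i ∈ T, (Ioo i.1 i.2).indicator 1 x ∂τ := by
        rw [← Finset.mul_sum, lintegral_finsetSum _ fun i _ =>
          measurable_one.indicator measurableSet_Ioo]
        simp only [lintegral_indicator_one measurableSet_Ioo]
    _ ≤ c * ∫⁻ _, 2 ∂τ := by
        gcongr with x
        simp only [indicator_apply, Pi.one_apply, Finset.sum_boole]
        exact_mod_cast hT2 x
    _ = c * (2 * τ univ) := by rw [lintegral_const]

theorem measure_biUnion_Ioo_le [SecondCountableTopology α] (S : Set (α × α))
    (h : ∀ i ∈ S, σ (Ioo i.1 i.2) ≤ c * τ (Ioo i.1 i.2)) :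
    σ (⋃ i ∈ S, Ioo i.1 i.2) ≤ c * (2 * τ univ) := by
  classical
  obtain ⟨T, hTS, hTc, hTU⟩ := TopologicalSpace.isOpen_biUnion_countable S
    (fun i => Ioo i.1 i.2) fun i _ => isOpen_Ioo
  have := hTc.to_subtype
  rw [← hTU, biUnion_eq_iUnion, iUnion_eq_iUnion_finset, Directed.measure_iUnion]
  · refine iSup_le fun A => ?_
    simpa using measure_biUnion_finset_Ioo_le (A.image Subtype.val) fun i hi => by
      obtain ⟨j, -, rfl⟩ := Finset.mem_image.1 hi
      exact h _ (hTS j.2)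
  · exact directed_of_isDirected_le fun A B hAB => biUnion_subset_biUnion_left hAB

end IntervalCovering

section MaximalIntervals

variable {α : Type*} [LinearOrder α]

/-- The endpoint pairs of the maximal open intervals contained in `O`, for an open set `O` that is
bounded: the interval is inside `O` and its endpoints are outside. -/
def maximalIntervals (O : Set α) : Set (α × α) :=
  {i | i.1 < i.2 ∧ Ioo i.1 i.2 ⊆ O ∧ i.1 ∉ O ∧ i.2 ∉ O}

theorem pairwiseDisjoint_maximalIntervals (O : Set α) :
    (maximalIntervals O).PairwiseDisjoint fun i => Ioo i.1 i.2 := by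
  rintro i ⟨-, hi, hi₁, hi₂⟩ j ⟨-, hj, hj₁, hj₂⟩ hij
  refine disjoint_left.2 fun z hzi hzj => hij (Prod.ext ?_ ?_)
  · exact le_antisymm (not_lt.1 fun h => hi₁ (hj ⟨h, hzi.1.trans hzj.2⟩))
      (not_lt.1 fun h => hj₁ (hi ⟨h, hzj.1.trans hzi.2⟩))
  · exact le_antisymm (not_lt.1 fun h => hj₂ (hi ⟨hzi.1.trans hzj.2, h⟩))
      (not_lt.1 fun h => hi₂ (hj ⟨hzj.1.trans hzi.2, h⟩))

theorem countable_maximalIntervals [TopologicalSpace α] [OrderTopology α] [DenselyOrdered α]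
    [TopologicalSpace.SeparableSpace α] (O : Set α) : (maximalIntervals O).Countable :=
  (pairwiseDisjoint_maximalIntervals O).countable_of_isOpen (fun _ _ => isOpen_Ioo)
    fun _ hi => nonempty_Ioo.2 hi.1

theorem exists_maximalIntervals_Ioo_subset {α : Type*} [ConditionallyCompleteLinearOrder α]
    [TopologicalSpace α] [OrderTopology α] [DenselyOrdered α] [NoMinOrder α] [NoMaxOrder α]
    {O : Set α} (hO : IsOpen O) (hbb : BddBelow O) (hba : BddAbove O) {a b : α} (hab : a < b)
    (h : Ioo a b ⊆ O) : ∃ i ∈ maximalIntervals O, Ioo a b ⊆ Ioo i.1 i.2 := by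
  obtain ⟨m, hm⟩ := nonempty_Ioo.2 hab
  obtain ⟨y, hy⟩ := hbb
  obtain ⟨y', hy'⟩ := exists_lt y
  obtain ⟨z, hz⟩ := hba
  obtain ⟨z', hz'⟩ := exists_gt z
  set L := Oᶜ ∩ Iic m
  set R := Oᶜ ∩ Ici m
  have hLb : BddAbove L := bddAbove_Iic.mono inter_subset_right
  have hRb : BddBelow R := bddBelow_Ici.mono inter_subset_right
  have hc : sSup L ∈ L := (hO.isClosed_compl.inter isClosed_Iic).csSup_mem
    ⟨y', fun hyO => (hy hyO).not_gt hy', hy'.le.trans (hy (h hm))⟩ hLb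
  have hd : sInf R ∈ R := (hO.isClosed_compl.inter isClosed_Ici).csInf_mem
    ⟨z', fun hzO => (hz hzO).not_gt hz', (hz (h hm)).trans hz'.le⟩ hRb
  have hca : sSup L ≤ a := not_lt.1 fun hac => hc.1 (h ⟨hac, hc.2.trans_lt hm.2⟩)
  have hbd : b ≤ sInf R := not_lt.1 fun hdb => hd.1 (h ⟨hm.1.trans_le hd.2, hdb⟩)
  refine ⟨(sSup L, sInf R), ⟨hca.trans_lt (hab.trans_le hbd), fun t ht => ?_, hc.1, hd.1⟩,
    Ioo_subset_Ioo hca hbd⟩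
  by_contra htO
  rcases le_total t m with htm | hmt
  · exact (le_csSup hLb ⟨htO, htm⟩).not_gt ht.1
  · exact (csInf_le hRb ⟨htO, hmt⟩).not_gt ht.2

end MaximalIntervals

section MaximalRatio

variable {w F : ℝ → ℝ≥0∞}

/-- The uncentered maximal function of `w` relative to `F`: the supremum of
`(∫_I w) / (∫_I F)` over the open intervals `I` containing `x`. It controls the reciprocals of the
averages of `F` that occur in the minimal function. -/
noncomputable def maximalRatio (w F : ℝ → ℝ≥0∞) (x : ℝ) : ℝ≥0∞ :=
  ⨆ (a : ℝ) (b : ℝ) (_ : x ∈ Ioo a b), (∫⁻ t in Ioo a b, w t) / ∫⁻ t in Ioo a b, F t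

theorem setOf_lt_maximalRatio (w F : ℝ → ℝ≥0∞) (r : ℝ≥0∞) :
    {x | r < maximalRatio w F x} =
      ⋃ i ∈ {i : ℝ × ℝ | r < (∫⁻ t in Ioo i.1 i.2, w t) / ∫⁻ t in Ioo i.1 i.2, F t},
        Ioo i.1 i.2 := by
  ext x
  simp only [maximalRatio, lt_iSup_iff, mem_iUnion, mem_ofPred_eq, Prod.exists, exists_prop,
    and_comm]

theorem isOpen_setOf_lt_maximalRatio (w F : ℝ → ℝ≥0∞) (r : ℝ≥0∞) :
    IsOpen {x | r < maximalRatio w F x} := by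
  rw [setOf_lt_maximalRatio]
  exact isOpen_biUnion fun _ _ => isOpen_Ioo

theorem maximalRatio_eq_zero_of_notMem {K : Set ℝ} (hK : IsClosed K) (hF : ∀ x ∉ K, F x = ∞)
    {x : ℝ} (hx : x ∉ K) : maximalRatio w F x = 0 := by
  simp only [maximalRatio, ENNReal.iSup_eq_zero]
  intro a b hxab
  have hopen : IsOpen (Ioo a b \ K) := isOpen_Ioo.sdiff hK
  have htop : ∫⁻ t in Ioo a b, F t = ∞ := by
    refine top_le_iff.1 (le_trans ?_ (lintegral_mono_set (sdiff_subset (s := Ioo a b) (t := K))))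
    rw [setLIntegral_congr_fun hopen.measurableSet fun t ht => hF t ht.2, setLIntegral_const,
      ENNReal.top_mul (hopen.measure_pos volume ⟨x, hxab, hx⟩).ne']
  rw [htop, ENNReal.div_top]

theorem setLIntegral_lt_maximalRatio_le (hw : AEMeasurable w) (hF : AEMeasurable F) {r : ℝ≥0∞}
    (hr : r ≠ 0) :
    ∫⁻ t in {t | r < maximalRatio w F t}, w t ≤ 4 * ∫⁻ t in {t | r < 2 * (w t / F t)}, w t := by
  set A := {t | r < 2 * (w t / F t)}
  have hcover := measure_biUnion_Ioo_le (σ := volume.withDensity w)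
    (τ := (volume.restrict A).withDensity w) (c := 2)
    {i : ℝ × ℝ | r < (∫⁻ t in Ioo i.1 i.2, w t) / ∫⁻ t in Ioo i.1 i.2, F t} fun i hi => by
      rw [withDensity_apply _ measurableSet_Ioo, withDensity_apply _ measurableSet_Ioo,
        Measure.restrict_comm measurableSet_Ioo]
      exact lintegral_le_two_mul_setLIntegral_of_lt_div hw.restrict hF.restrict hr hi
  rw [← setOf_lt_maximalRatio,
    withDensity_apply _ (isOpen_setOf_lt_maximalRatio w F r).measurableSet,
    withDensity_apply _ MeasurableSet.univ, Measure.restrict_univ, ← mul_assoc] at hcover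
  exact hcover.trans_eq (by norm_num)

/-- This is the strong type `(p, p)` inequality for `maximalRatio`, with the integral of
`maximalRatio w F ^ p` discretized along powers of two. -/
theorem tsum_two_zpow_mul_setLIntegral_lt_maximalRatio_rpow_le (hw : AEMeasurable w)
    (hF : AEMeasurable F) {p : ℝ} (hp : 0 < p) :
    ∑' k : ℤ, 2 ^ (k + 1) * ∫⁻ t in {t | 2 ^ k < maximalRatio w F t ^ p}, w t ≤
      16 * 2 ^ p * ∫⁻ t, (w t / F t) ^ p * w t := by
  have hlevel (k : ℤ) : ∫⁻ t in {t | 2 ^ k < maximalRatio w F t ^ p}, w t ≤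
      4 * ∫⁻ t in {t | 2 ^ k < (2 * (w t / F t)) ^ p}, w t := by
    simp only [← ENNReal.rpow_inv_lt_iff hp]
    refine setLIntegral_lt_maximalRatio_le hw hF ?_
    exact (ENNReal.rpow_pos (ENNReal.zpow_pos two_ne_zero ENNReal.ofNat_ne_top k)
      (ENNReal.zpow_ne_top two_ne_zero ENNReal.ofNat_ne_top k)).ne'
  calc ∑' k : ℤ, 2 ^ (k + 1) * ∫⁻ t in {t | 2 ^ k < maximalRatio w F t ^ p}, w t
      ≤ ∑' k : ℤ, 8 * (2 ^ k * ∫⁻ t in {t | 2 ^ k < (2 * (w t / F t)) ^ p}, w t) := by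
        refine ENNReal.tsum_le_tsum fun k => (mul_le_mul_right (hlevel k) _).trans_eq ?_
        rw [ENNReal.zpow_add two_ne_zero ENNReal.ofNat_ne_top, zpow_one]
        ring
    _ ≤ 8 * (2 * ∫⁻ t, (2 * (w t / F t)) ^ p * w t) := by
        rw [ENNReal.tsum_mul_left]
        gcongr
        exact tsum_two_zpow_mul_setLIntegral_le (((hw.div hF).const_mul 2).pow_const p) hw
    _ = 16 * 2 ^ p * ∫⁻ t, (w t / F t) ^ p * w t := by
        simp only [ENNReal.mul_rpow_of_nonneg _ _ hp.le, mul_assoc (2 ^ p : ℝ≥0∞)]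
        rw [lintegral_const_mul' _ _ (ENNReal.rpow_ne_top_of_nonneg hp.le ENNReal.ofNat_ne_top)]
        ring

theorem exists_zpow_Ioo_subset_lt_maximalRatio_rpow (hw : AEMeasurable w) (hF : AEMeasurable F)
    (hw0 : ∀ᵐ t, w t ≠ 0) {p : ℝ} (hp : 0 < p) (hN : ∫⁻ t, (w t / F t) ^ p * w t ≠ ∞) {a b : ℝ}
    (hab : a < b) (hFab : ∫⁻ t in Ioo a b, F t ≠ ∞) :
    ∃ k : ℤ, Ioo a b ⊆ {t | 2 ^ k < maximalRatio w F t ^ p} ∧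
      (∫⁻ t in Ioo a b, w t) ^ p ≤ 2 ^ (k + 1) * (∫⁻ t in Ioo a b, F t) ^ p := by
  have hνpos : volume.restrict (Ioo a b) ≠ 0 := by simpa using hab
  have hF0 := ae_ne_zero_of_lintegral_div_rpow_mul_ne_top hw hF hw0 hp hN
  have hFint : ∫⁻ t in Ioo a b, F t ≠ 0 :=
    lintegral_ne_zero_of_ae_ne_zero hνpos hF.restrict (ae_restrict_of_ae hF0)
  have hwint : ∫⁻ t in Ioo a b, w t ≠ 0 :=
    lintegral_ne_zero_of_ae_ne_zero hνpos hw.restrict (ae_restrict_of_ae hw0)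
  have hwtop : ∫⁻ t in Ioo a b, w t ≠ ∞ := ne_top_of_le_ne_top
    (ENNReal.add_ne_top.2 ⟨hFab, ne_top_of_le_ne_top hN (setLIntegral_le_lintegral _ _)⟩)
    (lintegral_le_lintegral_add_lintegral_div_rpow_mul hF.restrict hp)
  have hpos := ENNReal.div_ne_zero.2 ⟨hwint, hFab⟩
  have htop := ENNReal.div_ne_top hwtop hFint
  obtain ⟨k, hk, hk'⟩ := ENNReal.exists_mem_Ioc_zpow
    (ENNReal.rpow_pos (pos_iff_ne_zero.2 hpos) htop).ne'
    (ENNReal.rpow_ne_top_of_nonneg hp.le htop) ENNReal.one_lt_two ENNReal.ofNat_ne_top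
  refine ⟨k, fun x hx => hk.trans_le ?_, ?_⟩
  · exact ENNReal.rpow_le_rpow (le_iSup₂_of_le a b (le_iSup_of_le hx le_rfl)) hp.le
  · rwa [ENNReal.div_rpow_of_nonneg _ _ hp.le, ENNReal.div_le_iff] at hk'
    · exact (ENNReal.rpow_pos (pos_iff_ne_zero.2 hFint) hFab).ne'
    · exact ENNReal.rpow_ne_top_of_nonneg hp.le hFab

end MaximalRatio

section ExtendTop

variable {α : Type*} {F : α → ℝ≥0∞} {s t : Set α} {x : α}

/-- The function `F / χ_s`, equal to `F` on `s` and to `∞` outside `s`. -/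
noncomputable def extendTop (F : α → ℝ≥0∞) (s : Set α) (x : α) : ℝ≥0∞ :=
  F x + sᶜ.indicator (fun _ => ∞) x

theorem extendTop_of_mem (hx : x ∈ s) : extendTop F s x = F x := by simp [extendTop, hx]

theorem extendTop_of_notMem (hx : x ∉ s) : extendTop F s x = ∞ := by simp [extendTop, hx]

theorem le_extendTop (F : α → ℝ≥0∞) (s : Set α) : F ≤ extendTop F s := fun _ => le_self_add

theorem extendTop_anti (F : α → ℝ≥0∞) (h : s ⊆ t) : extendTop F t ≤ extendTop F s := fun x =>
  add_le_add_right (indicator_le_indicator_of_subset (compl_subset_compl.2 h)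
    (fun _ => zero_le) x) _

theorem aemeasurable_extendTop [MeasurableSpace α] {ν : Measure α} (hF : AEMeasurable F ν)
    (hs : MeasurableSet s) : AEMeasurable (extendTop F s) ν :=
  hF.add (aemeasurable_const.indicator hs.compl)

end ExtendTop

section MinimalFunction

variable {μ p q s : ℝ} {U w F : ℝ → ℝ≥0∞} {C : ℝ≥0∞}

/-- The minimal function `minimalPlus` for functions with values in `[0, ∞]`, on which it depends
only through `|f|`. The integrals are taken over open intervals. -/
noncomputable def eminimalPlus (μ : ℝ) (F : ℝ → ℝ≥0∞) (x : ℝ) : ℝ≥0∞ :=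
  ⨅ (h : ℝ) (_ : 0 < h), (∫⁻ t in Ioo x (x + h), F t) / ENNReal.ofReal (h ^ (1 + μ))

theorem minimalPlus_eq_eminimalPlus (μ : ℝ) (f : ℝ → EReal) :
    minimalPlus μ f = eminimalPlus μ fun t => (f t).abs := by
  ext x
  simp only [minimalPlus, eminimalPlus, restrict_Ioo_eq_restrict_Ioc]

theorem eminimalPlus_mono (μ : ℝ) : Monotone (eminimalPlus μ) := fun _ _ h _ =>
  iInf₂_mono fun _ _ => ENNReal.div_le_div_right (lintegral_mono h) _

theorem eminimalPlus_extendTop_le (μ : ℝ) (F : ℝ → ℝ≥0∞) {S : Set ℝ} {x h : ℝ} (hh : 0 < h)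
    (hS : Ioo x (x + h) ⊆ S) :
    eminimalPlus μ (extendTop F S) x ≤
      (∫⁻ t in Ioo x (x + h), F t) / ENNReal.ofReal (h ^ (1 + μ)) := by
  refine (iInf₂_le h hh).trans_eq ?_
  rw [setLIntegral_congr_fun measurableSet_Ioo fun t ht => extendTop_of_mem (hS ht)]

theorem eminimalPlus_eq_iInf_rat (μ : ℝ) (F : ℝ → ℝ≥0∞) (x : ℝ) :
    eminimalPlus μ F x = ⨅ (r : ℚ) (_ : 0 < r),
      (∫⁻ t in Ioo x (x + r), F t) / ENNReal.ofReal ((r : ℝ) ^ (1 + μ)) := by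
  refine le_antisymm (le_iInf₂ fun r hr => iInf₂_le (r : ℝ) (by exact_mod_cast hr))
    (le_iInf₂ fun h hh => ?_)
  obtain ⟨u, -, hu, hlim⟩ :=
    DenseRange.exists_seq_strictMono_tendsto_of_lt Rat.denseRange_cast Rat.cast_mono hh
  have hdiv : Filter.Tendsto
      (fun n => (∫⁻ t in Ioo x (x + h), F t) / ENNReal.ofReal ((u n : ℝ) ^ (1 + μ)))
      Filter.atTop
      (nhds ((∫⁻ t in Ioo x (x + h), F t) / ENNReal.ofReal (h ^ (1 + μ)))) :=
    ENNReal.Tendsto.const_div (ENNReal.tendsto_ofReal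
      ((Real.continuousAt_rpow_const h (1 + μ) (.inl hh.ne')).tendsto.comp hlim))
      (.inl ENNReal.ofReal_ne_top)
  refine ge_of_tendsto' hdiv fun n => (iInf₂_le (u n) (by exact_mod_cast (hu n).1)).trans ?_
  gcongr
  exact (hu n).2.le

theorem measurable_eminimalPlus (μ : ℝ) (hF : AEMeasurable F) : Measurable (eminimalPlus μ F) := by
  rw [funext (eminimalPlus_eq_iInf_rat μ F)]
  refine Measurable.iInf fun r => Measurable.iInf fun _ => Measurable.div_const ?_ _
  have hprod (x : ℝ) : ∫⁻ t in Ioo x (x + r), F t =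
      ∫⁻ t, {z : ℝ × ℝ | z.1 < z.2 ∧ z.2 < z.1 + r}.indicator (fun z => hF.mk F z.2) (x, t) := by
    rw [lintegral_congr_ae (ae_restrict_of_ae hF.ae_eq_mk), ← lintegral_indicator measurableSet_Ioo]
    rfl
  simp only [hprod]
  refine Measurable.lintegral_prod_right' ((hF.measurable_mk.comp measurable_snd).indicator ?_)
  exact (measurableSet_lt measurable_fst measurable_snd).inter
    (measurableSet_lt measurable_snd (measurable_fst.add_const _))

theorem aemeasurable_div_eminimalPlus_rpow (μ q : ℝ) (hU : AEMeasurable U) (hF : AEMeasurable F) :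
    AEMeasurable fun x => U x / eminimalPlus μ F x ^ q :=
  hU.div ((measurable_eminimalPlus μ hF).pow_const q).aemeasurable

/-- `C` is an admissible constant in the testing condition for the pair `(U, w)`, with exponent `s`
(equal to `q / p` in `TestingCondition`) on the right-hand side. -/
def IsTestingConstant (μ q s : ℝ) (U w : ℝ → ℝ≥0∞) (C : ℝ≥0∞) : Prop :=
  ∀ a b : ℝ, a < b → ∫⁻ x in Icc a b, U x / eminimalPlus μ (extendTop w (Icc a b)) x ^ q ≤
    C * (∫⁻ x in Icc a b, w x) ^ s

/-- The sum of the integrands of the testing condition over the closures of the maximal intervals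
of `O`. It dominates `U x / ((∫_x^{x+h} w) / h ^ (1 + μ)) ^ q` for all `h > 0` with
`(x, x + h) ⊆ O`, independently of `h`. -/
noncomputable def intervalMajorant (μ q : ℝ) (U w : ℝ → ℝ≥0∞) (O : Set ℝ) (x : ℝ) : ℝ≥0∞ :=
  ∑' i : maximalIntervals O, (Icc i.1.1 i.1.2).indicator
    (fun x => U x / eminimalPlus μ (extendTop w (Icc i.1.1 i.1.2)) x ^ q) x

theorem aemeasurable_intervalMajorant_summand (μ q : ℝ) (hU : AEMeasurable U) (hw : AEMeasurable w)
    (a b : ℝ) : AEMeasurable ((Icc a b).indicator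
      fun x => U x / eminimalPlus μ (extendTop w (Icc a b)) x ^ q) :=
  (aemeasurable_div_eminimalPlus_rpow μ q hU
    (aemeasurable_extendTop hw measurableSet_Icc)).indicator measurableSet_Icc

theorem aemeasurable_intervalMajorant (μ q : ℝ) (hU : AEMeasurable U) (hw : AEMeasurable w)
    (O : Set ℝ) : AEMeasurable (intervalMajorant μ q U w O) := by
  have := (countable_maximalIntervals O).to_subtype
  exact AEMeasurable.tsum fun i => aemeasurable_intervalMajorant_summand μ q hU hw _ _

theorem lintegral_intervalMajorant_le (hC : IsTestingConstant μ q s U w C) (hs : 1 ≤ s)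
    (hU : AEMeasurable U) (hw : AEMeasurable w) (O : Set ℝ) :
    ∫⁻ x, intervalMajorant μ q U w O x ≤ C * (∫⁻ x in O, w x) ^ s := by
  have hcount := countable_maximalIntervals O
  have := hcount.to_subtype
  calc ∫⁻ x, intervalMajorant μ q U w O x
      = ∑' i : maximalIntervals O, ∫⁻ x in Icc i.1.1 i.1.2,
          U x / eminimalPlus μ (extendTop w (Icc i.1.1 i.1.2)) x ^ q := by
        simp only [intervalMajorant]
        rw [lintegral_tsum fun i => aemeasurable_intervalMajorant_summand μ q hU hw _ _]
        simp only [lintegral_indicator measurableSet_Icc]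
    _ ≤ ∑' i : maximalIntervals O, C * (∫⁻ x in Ioo i.1.1 i.1.2, w x) ^ s := by
        gcongr with i
        rw [restrict_Ioo_eq_restrict_Icc]
        exact hC _ _ i.2.1
    _ ≤ C * (∑' i : maximalIntervals O, ∫⁻ x in Ioo i.1.1 i.1.2, w x) ^ s := by
        rw [ENNReal.tsum_mul_left]
        gcongr
        exact tsum_rpow_le_rpow_tsum _ hs
    _ = C * (∫⁻ x in ⋃ i ∈ maximalIntervals O, Ioo i.1 i.2, w x) ^ s := by
        rw [lintegral_biUnion hcount (fun _ _ => measurableSet_Ioo)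
          (pairwiseDisjoint_maximalIntervals O)]
    _ ≤ C * (∫⁻ x in O, w x) ^ s := by
        gcongr
        exact iUnion₂_subset fun i hi => hi.2.1

theorem le_intervalMajorant (μ : ℝ) (hq : 0 ≤ q) (U w : ℝ → ℝ≥0∞) {O : Set ℝ} (hO : IsOpen O)
    (hbb : BddBelow O) (hba : BddAbove O) {x h : ℝ} (hh : 0 < h) (hx : Ioo x (x + h) ⊆ O) :
    U x / ((∫⁻ t in Ioo x (x + h), w t) / ENNReal.ofReal (h ^ (1 + μ))) ^ q ≤
      intervalMajorant μ q U w O x := by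
  have hxh : x < x + h := lt_add_of_pos_right x hh
  obtain ⟨i, hi, hxi⟩ := exists_maximalIntervals_Ioo_subset hO hbb hba hxh hx
  have hle := (Ioo_subset_Ioo_iff hxh).1 hxi
  refine le_trans ?_ (ENNReal.le_tsum (⟨i, hi⟩ : maximalIntervals O))
  rw [indicator_of_mem (mem_Icc.2 ⟨hle.1, hxh.le.trans hle.2⟩)]
  gcongr
  exact eminimalPlus_extendTop_le μ w hh (hxi.trans Ioo_subset_Icc_self)

theorem div_div_rpow_le_mul {u a b H c : ℝ≥0∞} (hq : 0 ≤ q) (hc0 : c ≠ 0) (hc : c ≠ ∞)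
    (h : a ^ q ≤ c * b ^ q) : u / (b / H) ^ q ≤ c * (u / (a / H) ^ q) := by
  calc u / (b / H) ^ q = c * u / (c * (b / H) ^ q) := (ENNReal.mul_div_mul_left _ _ hc0 hc).symm
    _ ≤ c * u / (a / H) ^ q := by
        refine ENNReal.div_le_div_left ?_ _
        rw [ENNReal.div_rpow_of_nonneg _ _ hq, ENNReal.div_rpow_of_nonneg _ _ hq, ← mul_div_assoc]
        exact ENNReal.div_le_div_right h _
    _ = c * (u / (a / H) ^ q) := mul_div_assoc _ _ _

theorem div_eminimalPlus_rpow_le_tsum (μ : ℝ) (hp : 0 < p) (hq : 0 < q) (U : ℝ → ℝ≥0∞)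
    (hw : AEMeasurable w) (hF : AEMeasurable F) (hw0 : ∀ᵐ t, w t ≠ 0)
    (hN : ∫⁻ t, (w t / F t) ^ p * w t ≠ ∞) {K : Set ℝ} (hK : IsCompact K)
    (hFK : ∀ x ∉ K, F x = ∞) (x : ℝ) :
    U x / eminimalPlus μ F x ^ q ≤ ∑' k : ℤ, (2 ^ (k + 1)) ^ (q / p) *
      intervalMajorant μ q U w {t | 2 ^ k < maximalRatio w F t ^ p} x := by
  simp only [eminimalPlus, div_iInf_rpow _ _ hq]
  refine iSup₂_le fun h hh => ?_
  rcases eq_or_ne (∫⁻ t in Ioo x (x + h), F t) ∞ with htop | hfin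
  · rw [htop, ENNReal.top_div_of_ne_top ENNReal.ofReal_ne_top, ENNReal.top_rpow_of_pos hq,
      ENNReal.div_top]
    exact zero_le
  obtain ⟨k, hkO, hk⟩ := exists_zpow_Ioo_subset_lt_maximalRatio_rpow hw hF hw0 hp hN
    (lt_add_of_pos_right x hh) hfin
  set O := {t | 2 ^ k < maximalRatio w F t ^ p}
  have hO : IsOpen O := by
    simp only [O, ← ENNReal.rpow_inv_lt_iff hp]
    exact isOpen_setOf_lt_maximalRatio w F _
  have hOK : O ⊆ K := by
    intro t ht
    by_contra htK
    have htO : 2 ^ k < maximalRatio w F t ^ p := ht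
    simp [maximalRatio_eq_zero_of_notMem hK.isClosed hFK htK, hp] at htO
  have hkq : (∫⁻ t in Ioo x (x + h), w t) ^ q ≤
      (2 ^ (k + 1)) ^ (q / p) * (∫⁻ t in Ioo x (x + h), F t) ^ q := by
    have hpow := ENNReal.rpow_le_rpow hk (div_nonneg hq.le hp.le)
    rwa [ENNReal.mul_rpow_of_nonneg _ _ (div_nonneg hq.le hp.le), ← ENNReal.rpow_mul,
      ← ENNReal.rpow_mul, mul_div_cancel₀ q hp.ne'] at hpow
  have htwo : (2 : ℝ≥0∞) ^ (k + 1) ≠ ∞ := ENNReal.zpow_ne_top two_ne_zero ENNReal.ofNat_ne_top _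
  have htwo0 := ENNReal.zpow_pos (two_ne_zero (α := ℝ≥0∞)) ENNReal.ofNat_ne_top (k + 1)
  refine (div_div_rpow_le_mul hq.le (ENNReal.rpow_pos htwo0 htwo).ne'
    (ENNReal.rpow_ne_top_of_nonneg (by positivity) htwo) hkq).trans
    (le_trans ?_ (ENNReal.le_tsum k))
  gcongr
  exact le_intervalMajorant μ hq.le U w hO (hK.bddBelow.mono hOK) (hK.bddAbove.mono hOK) hh hkO

theorem lintegral_div_eminimalPlus_rpow_le_of_eq_top (hp : 0 < p) (hpq : p ≤ q)
    (hU : AEMeasurable U) (hw : AEMeasurable w) (hF : AEMeasurable F) (hw0 : ∀ᵐ t, w t ≠ 0)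
    (hN : ∫⁻ t, (w t / F t) ^ p * w t ≠ ∞) (hC : IsTestingConstant μ q (q / p) U w C) {K : Set ℝ}
    (hK : IsCompact K) (hFK : ∀ x ∉ K, F x = ∞) :
    ∫⁻ x, U x / eminimalPlus μ F x ^ q ≤
      C * (16 * 2 ^ p * ∫⁻ t, (w t / F t) ^ p * w t) ^ (q / p) := by
  have hs : 1 ≤ q / p := (one_le_div hp).2 hpq
  have hs0 : 0 ≤ q / p := zero_le_one.trans hs
  have hcoeff (k : ℤ) : ((2 : ℝ≥0∞) ^ (k + 1)) ^ (q / p) ≠ ∞ :=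
    ENNReal.rpow_ne_top_of_nonneg hs0 (ENNReal.zpow_ne_top two_ne_zero ENNReal.ofNat_ne_top _)
  let O (k : ℤ) : Set ℝ := {t | 2 ^ k < maximalRatio w F t ^ p}
  calc ∫⁻ x, U x / eminimalPlus μ F x ^ q
      ≤ ∫⁻ x, ∑' k : ℤ, (2 ^ (k + 1)) ^ (q / p) * intervalMajorant μ q U w (O k) x :=
        lintegral_mono
          (div_eminimalPlus_rpow_le_tsum μ hp (hp.trans_le hpq) U hw hF hw0 hN hK hFK)
    _ = ∑' k : ℤ, (2 ^ (k + 1)) ^ (q / p) * ∫⁻ x, intervalMajorant μ q U w (O k) x := by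
        rw [lintegral_tsum fun k => (aemeasurable_intervalMajorant μ q hU hw (O k)).const_mul _]
        exact tsum_congr fun k => lintegral_const_mul' _ _ (hcoeff k)
    _ ≤ ∑' k : ℤ, C * (2 ^ (k + 1) * ∫⁻ t in O k, w t) ^ (q / p) := by
        refine ENNReal.tsum_le_tsum fun k => ?_
        rw [ENNReal.mul_rpow_of_nonneg _ _ hs0, mul_left_comm]
        gcongr
        exact lintegral_intervalMajorant_le hC hs hU hw (O k)
    _ ≤ C * (∑' k : ℤ, 2 ^ (k + 1) * ∫⁻ t in O k, w t) ^ (q / p) := by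
        rw [ENNReal.tsum_mul_left]
        gcongr
        exact tsum_rpow_le_rpow_tsum _ hs
    _ ≤ C * (16 * 2 ^ p * ∫⁻ t, (w t / F t) ^ p * w t) ^ (q / p) := by
        gcongr
        exact tsum_two_zpow_mul_setLIntegral_lt_maximalRatio_rpow_le hw hF hp

theorem eminimalPlus_eq_iInf_extendTop_Icc (μ : ℝ) (F : ℝ → ℝ≥0∞) (x : ℝ) :
    eminimalPlus μ F x = ⨅ n : ℕ, eminimalPlus μ (extendTop F (Icc (-(n : ℝ)) n)) x := by
  refine le_antisymm (le_iInf fun n => eminimalPlus_mono μ (le_extendTop F _) x)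
    (le_iInf₂ fun h hh => ?_)
  obtain ⟨n, hn⟩ := exists_nat_ge (max (-x) (x + h))
  rw [max_le_iff] at hn
  refine (iInf_le _ n).trans (eminimalPlus_extendTop_le μ F hh fun y hy => ?_)
  exact ⟨by linarith [hy.1], by linarith [hy.2]⟩

theorem lintegral_div_eminimalPlus_rpow_le (hp : 0 < p) (hpq : p ≤ q) (hU : AEMeasurable U)
    (hw : AEMeasurable w) (hF : AEMeasurable F) (hw0 : ∀ᵐ t, w t ≠ 0) (hC0 : C ≠ 0)
    (hC : IsTestingConstant μ q (q / p) U w C) :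
    ∫⁻ x, U x / eminimalPlus μ F x ^ q ≤
      C * (16 * 2 ^ p * ∫⁻ t, (w t / F t) ^ p * w t) ^ (q / p) := by
  have hq : 0 < q := hp.trans_le hpq
  rcases eq_or_ne (∫⁻ t, (w t / F t) ^ p * w t) ∞ with hN | hN
  · rw [hN, ENNReal.mul_top (by positivity), ENNReal.top_rpow_of_pos (div_pos hq hp),
      ENNReal.mul_top hC0]
    exact le_top
  let F' (n : ℕ) : ℝ → ℝ≥0∞ := extendTop F (Icc (-(n : ℝ)) n)
  have hF' (n : ℕ) : AEMeasurable (F' n) := aemeasurable_extendTop hF measurableSet_Icc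
  have hF'_anti : Antitone F' := fun n m hnm => extendTop_anti F <| by gcongr
  have hN' (n : ℕ) : ∫⁻ t, (w t / F' n t) ^ p * w t ≤ ∫⁻ t, (w t / F t) ^ p * w t := by
    gcongr with t
    exact le_extendTop F _ t
  simp only [eminimalPlus_eq_iInf_extendTop_Icc μ F, div_iInf_rpow _ _ hq]
  rw [lintegral_iSup' fun n => aemeasurable_div_eminimalPlus_rpow μ q hU (hF' n)]
  · refine iSup_le fun n => (lintegral_div_eminimalPlus_rpow_le_of_eq_top hp hpq hU hw (hF' n) hw0
      (ne_top_of_le_ne_top hN (hN' n)) hC isCompact_Icc fun x => extendTop_of_notMem).trans ?_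
    gcongr C * (16 * 2 ^ p * ?_) ^ (q / p)
    exact hN' n
  · refine Filter.Eventually.of_forall fun x n m hnm => ENNReal.div_le_div_left ?_ _
    exact ENNReal.rpow_le_rpow (eminimalPlus_mono μ (hF'_anti hnm) x) hq.le

end MinimalFunction

section TestingAndStrongType

variable {μ p q : ℝ} {U V w : ℝ → ℝ}

theorem abs_divIndicator (hw : ∀ x, 0 ≤ w x) (s : Set ℝ) (x : ℝ) :
    (divIndicator w s x).abs = extendTop (fun t => ENNReal.ofReal (w t)) s x := by
  by_cases hx : x ∈ s
  · rw [divIndicator, if_pos hx, extendTop_of_mem hx, EReal.abs_def, abs_of_nonneg (hw x)]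
  · rw [divIndicator, if_neg hx, extendTop_of_notMem hx, EReal.abs_top]

theorem minimalPlus_divIndicator (μ : ℝ) (hw : ∀ x, 0 ≤ w x) (s : Set ℝ) :
    minimalPlus μ (divIndicator w s) =
      eminimalPlus μ (extendTop (fun t => ENNReal.ofReal (w t)) s) := by
  simp only [minimalPlus_eq_eminimalPlus, abs_divIndicator hw]

theorem aemeasurable_divIndicator {ν : Measure ℝ} (hw : AEMeasurable w ν) {s : Set ℝ}
    (hs : MeasurableSet s) : AEMeasurable (divIndicator w s) ν := by
  classical
  refine ⟨s.piecewise (fun t => ((hw.mk w t : ℝ) : EReal)) fun _ => ⊤,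
    hw.measurable_mk.coe_real_ereal.piecewise hs measurable_const, ?_⟩
  filter_upwards [hw.ae_eq_mk] with x hx
  simp only [divIndicator, piecewise, hx]

theorem omegaWeight_nonneg (hV : ∀ x, 0 ≤ V x) (p x : ℝ) : 0 ≤ omegaWeight p V x :=
  Real.rpow_nonneg (hV x) _

theorem ofReal_div_rpow_eq_omegaWeight (hp : 0 < p) {x : ℝ} (hV : 0 ≤ V x) (y : ℝ≥0∞) :
    ENNReal.ofReal (V x) / y ^ p =
      (ENNReal.ofReal (omegaWeight p V x) / y) ^ p * ENNReal.ofReal (omegaWeight p V x) := by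
  have hpow : ENNReal.ofReal (V x) = ENNReal.ofReal (omegaWeight p V x) ^ p *
      ENNReal.ofReal (omegaWeight p V x) := by
    have hω : omegaWeight p V x ^ (p + 1) = V x := by
      rw [omegaWeight, one_div, Real.rpow_inv_rpow hV (by positivity)]
    conv_lhs => rw [← hω, ← ENNReal.ofReal_rpow_of_nonneg
      (show 0 ≤ omegaWeight p V x from Real.rpow_nonneg hV _) (by positivity)]
    rw [ENNReal.rpow_add_of_nonneg _ _ hp.le zero_le_one, ENNReal.rpow_one]
  rw [ENNReal.div_rpow_of_nonneg _ _ hp.le, hpow]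
  simp only [div_eq_mul_inv]
  ring

theorem ofReal_div_abs_divIndicator_omegaWeight_rpow (hp : 0 < p) (hV : ∀ x, 0 ≤ V x) (s : Set ℝ)
    (x : ℝ) : ENNReal.ofReal (V x) / (divIndicator (omegaWeight p V) s x).abs ^ p =
      s.indicator (fun t => ENNReal.ofReal (omegaWeight p V t)) x := by
  rw [abs_divIndicator (omegaWeight_nonneg hV p)]
  by_cases hx : x ∈ s
  · rw [indicator_of_mem hx, extendTop_of_mem hx, ofReal_div_rpow_eq_omegaWeight hp (hV x)]
    rcases eq_or_ne (ENNReal.ofReal (omegaWeight p V x)) 0 with h0 | h0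
    · rw [h0, mul_zero]
    · rw [ENNReal.div_self h0 ENNReal.ofReal_ne_top, ENNReal.one_rpow, one_mul]
  · rw [indicator_of_notMem hx, extendTop_of_notMem hx, ENNReal.top_rpow_of_pos hp,
      ENNReal.div_top]

theorem StrongTypeInequality.testingCondition (hp : 0 < p) (hVm : AEMeasurable V)
    (hV : ∀ x, 0 ≤ V x) (h : StrongTypeInequality μ p q U V) : TestingCondition μ p q U V := by
  obtain ⟨C, hC, hstrong⟩ := h
  have hω : AEMeasurable (omegaWeight p V) := hVm.pow_const _
  refine ⟨C, hC, fun a b _ => (setLIntegral_le_lintegral _ _).trans ?_⟩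
  have hab := hstrong _ (aemeasurable_divIndicator hω (measurableSet_Icc (a := a) (b := b)))
  simpa only [ofReal_div_abs_divIndicator_omegaWeight_rpow hp hV,
    lintegral_indicator measurableSet_Icc] using hab

theorem TestingCondition.strongTypeInequality (hp : 0 < p) (hpq : p ≤ q) (hU : AEMeasurable U)
    (hV : IsWeight V) (h : TestingCondition μ p q U V) : StrongTypeInequality μ p q U V := by
  obtain ⟨C, hC, htest⟩ := h
  have hω : AEMeasurable (omegaWeight p V) := hV.aemeasurable.pow_const _
  have hω0 : ∀ᵐ t, ENNReal.ofReal (omegaWeight p V t) ≠ 0 := by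
    filter_upwards [hV.pos_ae] with t ht
    exact (ENNReal.ofReal_pos.2 (Real.rpow_pos_of_pos ht _)).ne'
  simp only [minimalPlus_divIndicator μ (omegaWeight_nonneg hV.nonneg p)] at htest
  refine ⟨C * (16 * 2 ^ p) ^ (q / p), by positivity, fun f hf => ?_⟩
  have habs : AEMeasurable fun t => (f t).abs := (EReal.measurable_of_measurable_real
    (f := EReal.abs) (measurable_id.abs.ennreal_ofReal)).comp_aemeasurable hf
  have hconst : ENNReal.ofReal (C * (16 * 2 ^ p) ^ (q / p)) =
      ENNReal.ofReal C * (16 * 2 ^ p) ^ (q / p) := by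
    rw [ENNReal.ofReal_mul hC.le, ← ENNReal.ofReal_rpow_of_pos (by positivity),
      ENNReal.ofReal_mul (by norm_num), ← ENNReal.ofReal_rpow_of_pos two_pos,
      ENNReal.ofReal_ofNat, ENNReal.ofReal_ofNat]
  have hs : 0 ≤ q / p := div_nonneg (hp.le.trans hpq) hp.le
  rw [minimalPlus_eq_eminimalPlus, hconst, mul_assoc, ← ENNReal.mul_rpow_of_nonneg _ _ hs]
  simp only [ofReal_div_rpow_eq_omegaWeight hp (hV.nonneg _)]
  exact lintegral_div_eminimalPlus_rpow_le hp hpq hU.ennreal_ofReal hω.ennreal_ofReal habs hω0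
    (ENNReal.ofReal_pos.2 hC).ne' htest

end TestingAndStrongType

theorem theorem3p3_general (μ : ℝ) {p q : ℝ} (hp : 0 < p) (hpq : p ≤ q) {U V : ℝ → ℝ}
    (hU : AEMeasurable U) (hV : IsWeight V) :
    TestingCondition μ p q U V ↔ StrongTypeInequality μ p q U V :=
  ⟨fun h => h.strongTypeInequality hp hpq hU hV,
    fun h => h.testingCondition hp hV.aemeasurable hV.nonneg⟩

theorem theorem3p3 (μ p q : ℝ) (hμ : 0 ≤ μ) (hp : 0 < p) (hpq : p ≤ q)
    (U V : ℝ → ℝ) (hU : IsWeight U) (hV : IsWeight V) :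
    TestingCondition μ p q U V ↔ StrongTypeInequality μ p q U V :=
  theorem3p3_general μ hp hpq hU.aemeasurable hV
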